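/- Let $R$ be a commutative noetherian local ring with maximal ideal $\mathfrak m$. Let $\operatorname{mod} R$ be the category of finitely generated $R$-modules, and let $\mathrm{PD}(R)$ be its full subcategory of modules of finite projective dimension (the zero module included). A full subcategory of $\operatorname{mod} R$, closed under isomorphism, is called thick if it is closed under direct summands and, for every short exact sequence $0\to L\to M\to N\to 0$ in $\operatorname{mod} R$, if two of $L,M,N$ belong to it then so does the third. Suppose that $R$ has an isolated singularity, that is, $R_{\mathfrak p}$ is a regular local ring for every prime ideal $\mathfrak p\neq\mathfrak m$. Suppose also that $\mathfrak m$ is quasi-decomposable with an $R$-regular sequence $\boldsymbol x=x_1,\dots,x_n$ of length $n\ge 0$, that is, $\mathfrak m/(\boldsymbol x)$ is the direct sum of two nonzero submodules. Then the following hold. (1) If $\mathcal X$ is a thick subcategory of $\operatorname{mod} R$ that contains $R$ and at least one module of projective dimension $\ge n+2$ (possibly infinite), then $\mathcal X=\operatorname{mod} R$. (2) There is no thick subcategory $\mathcal X$ of $\operatorname{mod} R$ with $\mathrm{PD}(R)\subsetneq\mathcal X\subsetneq\operatorname{mod} R$. -/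

import Mathlib

open CategoryTheory

universe v u

/-- The singular locus `Sing R`: the primes `p` such that `R_p` is not a regular local ring. -/
def singularPrimes (R : Type u) [CommRing R] : Set (PrimeSpectrum R) :=
  {p | ¬ IsRegularLocalRing (Localization.AtPrime p.asIdeal)}

/-- A local ring has an isolated singularity if `R_p` is regular for every prime `p` other than
the maximal ideal, that is, if `Sing R ⊆ {m}`. -/
def HasIsolatedSingularity (R : Type u) [CommRing R] [IsLocalRing R] : Prop :=
  singularPrimes R ⊆ {IsLocalRing.closedPoint R}

/-- A module is decomposable if it is the (internal) direct sum of two nonzero submodules. -/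
def IsDecomposableModule (R : Type u) [CommRing R] (M : Type v) [AddCommGroup M] [Module R M] :
    Prop :=
  ∃ N₁ N₂ : Submodule R M, N₁ ≠ ⊥ ∧ N₂ ≠ ⊥ ∧ IsCompl N₁ N₂

/-- The maximal ideal `m` of the local ring `R` is quasi-decomposable with the sequence `xs`:
`xs` is an `R`-regular sequence and the `R`-module `m / (xs)` is decomposable.
(An `R`-regular sequence of a local ring generates a proper ideal, so `(xs) ⊆ m`.) -/
structure IsQuasiDecomposableWith (R : Type u) [CommRing R] [IsLocalRing R] (xs : List R) :
    Prop where
  isRegular : RingTheory.Sequence.IsRegular R xs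
  isDecomposable : IsDecomposableModule R
    (↥(IsLocalRing.maximalIdeal R) ⧸
      Submodule.submoduleOf (Ideal.ofList xs) (IsLocalRing.maximalIdeal R))

/-- A (full) subcategory of an abelian category is thick if it is closed under direct summands
and, whenever two of the terms of a short exact sequence belong to it, so does the third.
Closure under isomorphisms is included, as an isomorphism makes its source a retract of its
target. -/
structure IsThickSubcategory {C : Type u} [Category.{v} C] [Abelian C] (P : ObjectProperty C) :
    Prop where
  of_retract : ∀ {X Y : C}, Retract X Y → P Y → P X
  left : ∀ {S : ShortComplex C}, S.ShortExact → P S.X₂ → P S.X₃ → P S.X₁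
  middle : ∀ {S : ShortComplex C}, S.ShortExact → P S.X₁ → P S.X₃ → P S.X₂
  right : ∀ {S : ShortComplex C}, S.ShortExact → P S.X₁ → P S.X₂ → P S.X₃

/-- The projective dimension of a finitely generated module, with values in
`{-∞} ∪ ℕ ∪ {∞}`; it is `-∞ = ⊥` exactly for the zero module. -/
noncomputable def moduleProjDim {R : Type u} [CommRing R] (M : FGModuleCat.{u} R) : WithBot ℕ∞ :=
  projectiveDimension M.obj

/-- `PD(R)`: the subcategory of `mod R` of all modules of finite projective dimension (including
the zero module). -/
def finiteProjDim (R : Type u) [CommRing R] : ObjectProperty (FGModuleCat.{u} R) :=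
  fun M => moduleProjDim M ≠ ⊤

/-! Write `q = (x)` and lift the decomposition of `m/q` to ideals with `I ∩ J = q` and `I + J = m`.
The proof shows that `𝒳` contains the residue field `k`, and then that `R` and `k` generate `mod R`.

Reaching `k`. After `n` syzygies the given module becomes some `L` of projective dimension at least
2 on which `x` is weakly regular. Let `N` be a syzygy of `L` and `K` a minimal syzygy of `N`; then
`K ≠ 0`, and `K/qK` embeds in a free `R/q`-module with image `W` having entries in `m/q`. Split `v ∈
K` as `a + b` with entries in `I` and `J`. The images of `a` and `-b` in the free cover of `L`
agree, so they have entries in `I ∩ J = q`; regularity then corrects `a` and `b` modulo `q` to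
elements of `K`. So `W` is the direct sum of a part killed by `J` and one killed by `I`
(`residueField_of_decomposition`). A nonzero module killed by `J` has a syzygy over `R/q` with
summand `J/q`; this is killed by `I`, so the same argument yields `I/q`. Hence `m/q = I/q ⊕ J/q` and
then `k` lie in `𝒳`.

From `k` to everything. Noetherian induction puts every `R/a` in `𝒳`. The essential case is a prime
`p ≠ m`: there `R_p` is regular, so `(R/p)_p` has finite projective dimension, and `R/p` is
recovered from the cocone of multiplication by a suitable `s ∉ p` (`exists_of_smulCocone`). That
cocone is the ideal `p + (s)`, which the induction provides. Prime filtrations finish part (1). For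
(2), a strictly larger thick subcategory contains `R` and a module of infinite projective dimension.
-/

/-! ### Closure properties of thick subcategories, in terms of linear maps. -/

namespace IsThickSubcategory

variable {R : Type u} [CommRing R] [IsNoetherianRing R] {X : ObjectProperty (FGModuleCat.{u} R)}
  {L M N : Type u} [AddCommGroup L] [Module R L] [Module.Finite R L]
  [AddCommGroup M] [Module R M] [Module.Finite R M]
  [AddCommGroup N] [Module R N] [Module.Finite R N]

theorem _root_.FGModuleCat.shortExact_of_exact {f : L →ₗ[R] M} {g : M →ₗ[R] N}
    (hf : Function.Injective f) (hfg : Function.Exact f g) (hg : Function.Surjective g) :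
    (ShortComplex.mk (FGModuleCat.ofHom f) (FGModuleCat.ofHom g)
      (by ext x; exact hfg.apply_apply_eq_zero x)).ShortExact := by
  apply ShortExact.reflects_shortExact_of_faithful (forget₂ (FGModuleCat.{u} R) (ModuleCat.{u} R))
  exact ModuleCat.shortComplex_shortExact _ hfg hf hg

theorem of_linearRetract (hX : IsThickSubcategory X) (i : M →ₗ[R] N) (r : N →ₗ[R] M)
    (h : r ∘ₗ i = LinearMap.id) (hN : X (FGModuleCat.of R N)) : X (FGModuleCat.of R M) :=
  hX.of_retract ⟨FGModuleCat.ofHom i, FGModuleCat.ofHom r, by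
    ext x; exact LinearMap.congr_fun h x⟩ hN

theorem of_linearEquiv (hX : IsThickSubcategory X) (e : N ≃ₗ[R] M)
    (hN : X (FGModuleCat.of R N)) : X (FGModuleCat.of R M) :=
  hX.of_linearRetract (e.symm : M →ₗ[R] N) e (by ext; simp) hN

theorem left_of_exact (hX : IsThickSubcategory X) {f : L →ₗ[R] M} {g : M →ₗ[R] N}
    (hf : Function.Injective f) (hfg : Function.Exact f g) (hg : Function.Surjective g)
    (hM : X (FGModuleCat.of R M)) (hN : X (FGModuleCat.of R N)) : X (FGModuleCat.of R L) :=
  hX.left (FGModuleCat.shortExact_of_exact hf hfg hg) hM hN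

theorem middle_of_exact (hX : IsThickSubcategory X) {f : L →ₗ[R] M} {g : M →ₗ[R] N}
    (hf : Function.Injective f) (hfg : Function.Exact f g) (hg : Function.Surjective g)
    (hL : X (FGModuleCat.of R L)) (hN : X (FGModuleCat.of R N)) : X (FGModuleCat.of R M) :=
  hX.middle (FGModuleCat.shortExact_of_exact hf hfg hg) hL hN

theorem right_of_exact (hX : IsThickSubcategory X) {f : L →ₗ[R] M} {g : M →ₗ[R] N}
    (hf : Function.Injective f) (hfg : Function.Exact f g) (hg : Function.Surjective g)
    (hL : X (FGModuleCat.of R L)) (hM : X (FGModuleCat.of R M)) : X (FGModuleCat.of R N) :=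
  hX.right (FGModuleCat.shortExact_of_exact hf hfg hg) hL hM

theorem ker (hX : IsThickSubcategory X) {g : M →ₗ[R] N} (hg : Function.Surjective g)
    (hM : X (FGModuleCat.of R M)) (hN : X (FGModuleCat.of R N)) :
    X (FGModuleCat.of R (LinearMap.ker g)) :=
  hX.left_of_exact (LinearMap.ker g).injective_subtype (LinearMap.exact_subtype_ker_map g) hg hM hN

theorem of_surjective (hX : IsThickSubcategory X) {g : M →ₗ[R] N} (hg : Function.Surjective g)
    (hK : X (FGModuleCat.of R (LinearMap.ker g))) (hM : X (FGModuleCat.of R M)) :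
    X (FGModuleCat.of R N) :=
  hX.right_of_exact (LinearMap.ker g).injective_subtype (LinearMap.exact_subtype_ker_map g) hg
    hK hM

theorem prod (hX : IsThickSubcategory X) (hM : X (FGModuleCat.of R M))
    (hN : X (FGModuleCat.of R N)) : X (FGModuleCat.of R (M × N)) :=
  hX.middle_of_exact (f := LinearMap.inl R M N) (g := LinearMap.snd R M N)
    LinearMap.inl_injective Function.Exact.inl_snd LinearMap.snd_surjective hM hN

theorem of_subsingleton (hX : IsThickSubcategory X) [Subsingleton N]
    (hM : X (FGModuleCat.of R M)) : X (FGModuleCat.of R N) :=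
  hX.of_linearRetract (0 : N →ₗ[R] M) 0 (by ext; exact Subsingleton.elim _ _) hM

theorem pi_fin (hX : IsThickSubcategory X) (hM : X (FGModuleCat.of R M)) (n : ℕ) :
    X (FGModuleCat.of R (Fin n → M)) := by
  induction n with
  | zero => exact hX.of_subsingleton hM
  | succ n ih => exact hX.of_linearEquiv (Fin.consLinearEquiv R fun _ => M) (hX.prod hM ih)

theorem of_sup (hX : IsThickSubcategory X) {A B : Submodule R M} (hAB : Disjoint A B)
    (h : X (FGModuleCat.of R ↥(A ⊔ B))) : X (FGModuleCat.of R A) := by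
  let φ : (A × B) →ₗ[R] ↥(A ⊔ B) :=
    (Submodule.inclusion le_sup_left).coprod (Submodule.inclusion le_sup_right)
  have hφ : Function.Bijective φ := by
    constructor
    · rw [← LinearMap.ker_eq_bot, LinearMap.ker_eq_bot']
      rintro ⟨a, b⟩ h0
      have h1 : (a : M) + b = 0 := congrArg Subtype.val h0
      have h2 : (a : M) = 0 := Submodule.disjoint_def.mp hAB a a.2 (by
        rw [eq_neg_of_add_eq_zero_left h1]; exact B.neg_mem b.2)
      have h3 : (b : M) = 0 := by simpa [h2] using h1
      ext <;> simp [h2, h3]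
    · rintro ⟨x, hx⟩
      obtain ⟨a, ha, b, hb, rfl⟩ := Submodule.mem_sup.mp hx
      exact ⟨(⟨a, ha⟩, ⟨b, hb⟩), rfl⟩
  have h2 := hX.of_linearEquiv (LinearEquiv.ofBijective φ hφ).symm h
  exact hX.of_linearRetract (LinearMap.inl R A B) (LinearMap.fst R A B) (by ext; simp) h2

end IsThickSubcategory

/-! ### Regular sequences along short exact sequences. -/

section Regular

open RingTheory.Sequence
open scoped Pointwise

variable {R : Type*} [CommRing R]

/-- This is the vanishing of `Tor₁(L, R/(rs))`: killing one `L`-regular element at a time keeps `K →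
F` injective. -/
theorem RingTheory.Sequence.IsWeaklyRegular.mem_smul_top_of_exact {K F L : Type*}
    [AddCommGroup K] [Module R K] [AddCommGroup F] [Module R F] [AddCommGroup L] [Module R L]
    {rs : List R} (hL : IsWeaklyRegular L rs) {f : K →ₗ[R] F} {g : F →ₗ[R] L}
    (hf : Function.Injective f) (hfg : Function.Exact f g) (hg : Function.Surjective g)
    {k : K} (hk : f k ∈ Ideal.ofList rs • (⊤ : Submodule R F)) :
    k ∈ Ideal.ofList rs • (⊤ : Submodule R K) := by
  induction rs generalizing K F L with
  | nil =>
    have : f k = 0 := by simpa using hk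
    simp [hf (this.trans (map_zero f).symm)]
  | cons r rs ih =>
    rw [isWeaklyRegular_cons_iff] at hL
    have h0 : Function.Injective (QuotSMulTop.map r f) := by
      have := QuotSMulTop.map_first_exact_on_four_term_exact_of_isSMulRegular_last
        (f₁ := (0 : K →ₗ[R] K)) ((LinearMap.exact_zero_iff_injective K f).mpr hf) hfg hL.1
      rw [map_zero] at this
      exact (LinearMap.exact_zero_iff_injective _ _).mp this
    have hnat := LinearMap.congr_fun
      (Submodule.quotOfListConsSMulTopEquivQuotSMulTopInner_naturality r rs f)
      (Submodule.Quotient.mk k)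
    have h1 : QuotSMulTop.map r f (Submodule.Quotient.mk k) ∈
        Ideal.ofList rs • (⊤ : Submodule R (QuotSMulTop r F)) := by
      rw [← Submodule.Quotient.mk_eq_zero]
      refine Eq.trans hnat.symm ?_
      have : Submodule.mapQ _ _ f (Submodule.smul_top_le_comap_smul_top (Ideal.ofList (r :: rs)) f)
          (Submodule.Quotient.mk k) = 0 := by
        rw [Submodule.mapQ_apply, Submodule.Quotient.mk_eq_zero]; exact hk
      rw [LinearMap.comp_apply, this, map_zero]
    have h2 := ih hL.2 h0 (QuotSMulTop.map_exact r hfg hg) (QuotSMulTop.map_surjective r hg) h1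
    rw [← Submodule.Quotient.mk_eq_zero] at h2 ⊢
    apply (Submodule.quotOfListConsSMulTopEquivQuotSMulTopInner K r rs).injective
    rw [map_zero]
    exact h2

/-- A form of the depth lemma: a syzygy can gain one regular element. Modulo `rs` the map `K → F` is
still injective, so an element regular on `F/(rs)F` is regular on `K/(rs)K`. -/
theorem RingTheory.Sequence.IsWeaklyRegular.concat_of_exact {K F L : Type*}
    [AddCommGroup K] [Module R K] [AddCommGroup F] [Module R F] [AddCommGroup L] [Module R L]
    {rs ss : List R} (hs : ss.length ≤ 1) (hL : IsWeaklyRegular L rs)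
    (hF : IsWeaklyRegular F (rs ++ ss)) {f : K →ₗ[R] F} {g : F →ₗ[R] L}
    (hf : Function.Injective f) (hfg : Function.Exact f g) (hg : Function.Surjective g) :
    IsWeaklyRegular K (rs ++ ss) := by
  induction rs generalizing K F L with
  | nil =>
    match ss, hs with
    | [], _ => exact .nil R K
    | [r], _ =>
      rw [List.nil_append, isWeaklyRegular_singleton_iff] at hF ⊢
      exact hF.of_injective f hf
  | cons r rs ih =>
    rw [List.cons_append, isWeaklyRegular_cons_iff] at hF ⊢
    rw [isWeaklyRegular_cons_iff] at hL
    have h0 : Function.Injective (QuotSMulTop.map r f) := by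
      have := QuotSMulTop.map_first_exact_on_four_term_exact_of_isSMulRegular_last
        (f₁ := (0 : K →ₗ[R] K)) ((LinearMap.exact_zero_iff_injective K f).mpr hf) hfg hL.1
      rw [map_zero] at this
      exact (LinearMap.exact_zero_iff_injective _ _).mp this
    exact ⟨hF.1.of_injective f hf, ih hL.2 hF.2 h0 (QuotSMulTop.map_exact r hfg hg)
      (QuotSMulTop.map_surjective r hg)⟩

theorem RingTheory.Sequence.IsWeaklyRegular.of_append_left {M : Type*} [AddCommGroup M]
    [Module R M] {rs ss : List R} (h : IsWeaklyRegular M (rs ++ ss)) : IsWeaklyRegular M rs :=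
  ((isWeaklyRegular_append_iff M rs ss).mp h).1

theorem RingTheory.Sequence.IsWeaklyRegular.pi_fin {rs : List R} (h : IsWeaklyRegular R rs)
    (n : ℕ) : IsWeaklyRegular (Fin n → R) rs := by
  have := h.isWeaklyRegular_lTensor (M₂ := Fin n → R)
  exact ((TensorProduct.rid R (Fin n → R)).isWeaklyRegular_congr rs).mp this

theorem IsThickSubcategory.quotient_ofList {R : Type u} [CommRing R] [IsNoetherianRing R]
    {X : ObjectProperty (FGModuleCat.{u} R)} (hX : IsThickSubcategory X) {K : Type u}
    [AddCommGroup K] [Module R K] [Module.Finite R K] (hK : X (FGModuleCat.of R K))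
    {rs : List R} (hrs : IsWeaklyRegular K rs) :
    X (FGModuleCat.of R (K ⧸ (Ideal.ofList rs • ⊤ : Submodule R K))) := by
  induction rs generalizing K with
  | nil =>
    exact hX.of_linearEquiv (Submodule.quotEquivOfEqBot _ (by simp)).symm hK
  | cons r rs ih =>
    rw [isWeaklyRegular_cons_iff] at hrs
    have h1 : X (FGModuleCat.of R (QuotSMulTop r K)) :=
      hX.right_of_exact (f := LinearMap.lsmul R K r) (g := (r • (⊤ : Submodule R K)).mkQ)
        hrs.1 (LinearMap.exact_lsmul_mkQ_smul_top K r) (Submodule.mkQ_surjective _) hK hK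
    exact hX.of_linearEquiv (Submodule.quotOfListConsSMulTopEquivQuotSMulTopInner K r rs).symm
      (ih h1 hrs.2)

end Regular

/-! ### Minimal generators over a local ring. -/

section MinimalCover

variable {R : Type u} [CommRing R] [IsLocalRing R] {M : Type u} [AddCommGroup M] [Module R M]
  [Module.Finite R M]

variable (R M) in
-- In a generating family of least size, a relation with a unit coefficient would make that
-- generator superfluous.
theorem IsLocalRing.exists_minimal_generators : ∃ (n : ℕ) (a : Fin n → M),
    Submodule.span R (Set.range a) = ⊤ ∧
      ∀ r : Fin n → R, ∑ i, r i • a i = 0 → ∀ i, r i ∈ maximalIdeal R := by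
  classical
  have hex : ∃ n, ∃ a : Fin n → M, Submodule.span R (Set.range a) = ⊤ := Module.Finite.exists_fin
  obtain ⟨a, ha⟩ := Nat.find_spec hex
  refine ⟨Nat.find hex, a, ha, fun r hr i₀ => ?_⟩
  by_contra hi
  rw [mem_maximalIdeal, mem_nonunits_iff, not_not] at hi
  obtain ⟨c, hc⟩ := hi.exists_left_inv
  obtain ⟨n, hn⟩ : ∃ n, Nat.find hex = n + 1 :=
    Nat.exists_eq_succ_of_ne_zero (fun h => by rw [h] at i₀; exact i₀.elim0)
  have hmin : ¬ ∃ a : Fin n → M, Submodule.span R (Set.range a) = ⊤ := Nat.find_min hex (by omega)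
  generalize Nat.find hex = k at *
  subst hn
  refine hmin ⟨a ∘ i₀.succAbove, top_le_iff.mp (ha ▸ Submodule.span_le.mpr ?_)⟩
  have hmem : ∀ j, a (i₀.succAbove j) ∈ Submodule.span R (Set.range (a ∘ i₀.succAbove)) :=
    fun j => Submodule.subset_span ⟨j, rfl⟩
  rintro _ ⟨i, rfl⟩
  obtain rfl | ⟨j, rfl⟩ := Fin.eq_self_or_eq_succAbove i₀ i
  · rw [Fin.sum_univ_succAbove _ i] at hr
    have : a i = -∑ j, (c * r (i.succAbove j)) • a (i.succAbove j) := by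
      have h := congrArg (c • ·) hr
      simp only [smul_add, smul_smul, hc, one_smul, smul_zero, Finset.smul_sum] at h
      exact eq_neg_of_add_eq_zero_left h
    rw [SetLike.mem_coe, this]
    exact Submodule.neg_mem _ (Submodule.sum_mem _ fun j _ => Submodule.smul_mem _ _ (hmem j))
  · exact hmem j

variable (R M) in
theorem IsLocalRing.exists_minimal_cover : ∃ (n : ℕ) (φ : (Fin n → R) →ₗ[R] M),
    Function.Surjective φ ∧ ∀ v, φ v = 0 → ∀ i, v i ∈ maximalIdeal R := by
  obtain ⟨n, a, ha, hmin⟩ := exists_minimal_generators R M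
  refine ⟨n, Fintype.linearCombination R a, ?_, fun v hv => hmin v ?_⟩
  · rw [← LinearMap.range_eq_top, Fintype.range_linearCombination, ha]
  · rwa [Fintype.linearCombination_apply] at hv

end MinimalCover

theorem Ideal.mem_smul_top_pi_iff {R : Type*} [CommRing R] (q : Ideal R) {n : ℕ} (v : Fin n → R) :
    v ∈ q • (⊤ : Submodule R (Fin n → R)) ↔ ∀ i, v i ∈ q := by
  refine ⟨fun h i => ?_, fun h => ?_⟩
  · have h1 := Submodule.smul_top_le_comap_smul_top q (LinearMap.proj (R := R) (φ := fun _ => R) i) h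
    simpa using h1
  · rw [← Finset.univ_sum_single v]
    refine Submodule.sum_mem _ fun i _ => ?_
    rw [show Pi.single i (v i) = v i • (Pi.single i 1 : Fin n → R) by
      rw [← Pi.single_smul, smul_eq_mul, mul_one]]
    exact Submodule.smul_mem_smul (h i) trivial

/-! ### From a decomposition of `m/q` to the residue field. -/

section QuasiDecomposable

open IsLocalRing RingTheory.Sequence

variable {R : Type u} [CommRing R]

/-- `I` and `J` are the preimages of the two summands. -/
theorem Ideal.exists_inf_sup_of_isDecomposableModule {m q : Ideal R} (hq : q ≤ m)
    (h : IsDecomposableModule R (↥m ⧸ Submodule.submoduleOf q m)) :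
    ∃ I J : Ideal R, I ⊓ J = q ∧ I ⊔ J = m ∧ ¬ I ≤ q ∧ ¬ J ≤ q := by
  obtain ⟨N₁, N₂, h₁, h₂, hc⟩ := h
  let π := (Submodule.submoduleOf q m).mkQ
  have hπ : Function.Surjective π := Submodule.mkQ_surjective _
  have hle : ∀ N : Submodule R (↥m ⧸ Submodule.submoduleOf q m),
      N ≠ ⊥ → ¬ (N.comap π).map m.subtype ≤ q := by
    intro N hN hle
    refine hN ((Submodule.eq_bot_iff N).mpr fun y hy => ?_)
    obtain ⟨x, rfl⟩ := hπ y
    exact (Submodule.Quotient.mk_eq_zero _).mpr (hle ⟨x, hy, rfl⟩)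
  refine ⟨(N₁.comap π).map m.subtype, (N₂.comap π).map m.subtype, ?_, ?_, hle _ h₁, hle _ h₂⟩
  · rw [← Submodule.map_inf _ m.injective_subtype, ← Submodule.comap_inf, hc.inf_eq_bot,
      ← LinearMap.ker, Submodule.ker_mkQ, Submodule.submoduleOf, Submodule.map_comap_subtype,
      inf_eq_right.mpr hq]
  · rw [← Submodule.map_sup]
    have : N₁.comap π ⊔ N₂.comap π = ⊤ := by
      rw [eq_top_iff]
      intro x _
      obtain ⟨a, ha, b, hb, hab⟩ := Submodule.mem_sup.mp
        (hc.sup_eq_top ▸ Submodule.mem_top : π x ∈ N₁ ⊔ N₂)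
      obtain ⟨a, rfl⟩ := hπ a
      have hb' : π (x - a) ∈ N₂ := by rw [map_sub, ← hab, add_sub_cancel_left]; exact hb
      rw [← add_sub_cancel a x]
      exact Submodule.add_mem_sup ha hb'
    rw [this, Submodule.map_top, Submodule.range_subtype]

theorem IsQuasiDecomposableWith.ofList_le [IsLocalRing R] {xs : List R}
    (h : IsQuasiDecomposableWith R xs) : Ideal.ofList xs ≤ maximalIdeal R :=
  le_maximalIdeal fun h' => h.isRegular.top_ne_smul (by simp [h'])

variable [IsNoetherianRing R] {X : ObjectProperty (FGModuleCat.{u} R)} {q I J : Ideal R}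

/-- The decomposition of syzygies over a fibre product: a nonzero module over `R ⧸ J` has a
syzygy over `R ⧸ q` with `J ⧸ q` as a direct summand. -/
theorem IsThickSubcategory.map_mkQ_of_smul_eq_zero [IsLocalRing R] (hX : IsThickSubcategory X)
    (hQ : X (FGModuleCat.of R (R ⧸ q))) (hinf : I ⊓ J = q) (hsup : I ⊔ J = maximalIdeal R)
    {A : Type u} [AddCommGroup A] [Module R A] [Module.Finite R A] [Nontrivial A]
    (hJ : ∀ r ∈ J, ∀ a : A, r • a = 0) (hA : X (FGModuleCat.of R A)) :
    X (FGModuleCat.of R (Submodule.map q.mkQ J)) := by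
  have hqI : q ≤ I := hinf ▸ inf_le_left
  have hqJ : q ≤ J := hinf ▸ inf_le_right
  obtain ⟨n, a, ha, hmin⟩ := exists_minimal_generators R A
  let ψ : Fin n → (R ⧸ q) →ₗ[R] A := fun i =>
    q.liftQ (LinearMap.toSpanSingleton R A (a i)) fun r hr => hJ r (hqJ hr) (a i)
  let φ : (Fin n → R ⧸ q) →ₗ[R] A := ∑ i, ψ i ∘ₗ LinearMap.proj i
  have hφ : ∀ v : Fin n → R, φ (fun i => q.mkQ (v i)) = ∑ i, v i • a i := fun v => by
    simp only [φ, ψ, LinearMap.sum_apply, LinearMap.comp_apply, LinearMap.proj_apply]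
    exact Finset.sum_congr rfl fun i _ => Submodule.liftQ_apply _ _ _
  have hsurj : Function.Surjective φ := by
    intro x
    obtain ⟨v, rfl⟩ := (Submodule.mem_span_range_iff_exists_fun R).mp
      (ha ▸ Submodule.mem_top : x ∈ Submodule.span R (Set.range a))
    exact ⟨_, hφ v⟩
  have hK := hX.ker hsurj (hX.pi_fin hQ n) hA
  obtain ⟨i₀⟩ : Nonempty (Fin n) := by
    by_contra h
    rw [not_nonempty_iff] at h
    rw [Set.range_eq_empty, Submodule.span_empty] at ha
    exact bot_ne_top ha
  -- The kernel will split as `C ⊕ B`: `C` is `J/q` placed in coordinate `i₀`, and `B` consists of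
  -- the relations whose `i₀`-th coordinate lies in `I/q`.
  let B : Submodule R (Fin n → R ⧸ q) :=
    LinearMap.ker φ ⊓ (Submodule.map q.mkQ I).comap (LinearMap.proj i₀)
  let s : (R ⧸ q) →ₗ[R] (Fin n → R ⧸ q) := LinearMap.single R (fun _ => R ⧸ q) i₀
  have hs : Function.Injective s := Pi.single_injective (M := fun _ => R ⧸ q) i₀
  let C : Submodule R (Fin n → R ⧸ q) := (Submodule.map q.mkQ J).map s
  have hC : C ≤ LinearMap.ker φ := by
    rintro _ ⟨_, ⟨r, hr, rfl⟩, rfl⟩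
    have : s (q.mkQ r) = fun i => q.mkQ ((Pi.single i₀ r : Fin n → R) i) := by
      ext i
      obtain rfl | hi := eq_or_ne i i₀
      · simp [s]
      · simp [s, hi]
    rw [LinearMap.mem_ker, this, hφ]
    refine Finset.sum_eq_zero fun i _ => ?_
    obtain rfl | hi := eq_or_ne i i₀
    · simpa using hJ r hr _
    · simp [hi]
  have hdisj : Disjoint C B := by
    rw [Submodule.disjoint_def]
    rintro _ ⟨_, ⟨r, hr, rfl⟩, rfl⟩ ⟨-, t, ht, hrt⟩
    have h1 : q.mkQ t = q.mkQ r := by simpa [s] using hrt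
    have h2 : t - r ∈ q := (Submodule.Quotient.eq q).mp h1
    have h3 : r ∈ I := by simpa using I.sub_mem ht (hqI h2)
    have h4 : q.mkQ r = 0 := (Submodule.Quotient.mk_eq_zero q).mpr (hinf ▸ ⟨h3, hr⟩)
    rw [h4, map_zero]
  have hCB : LinearMap.ker φ = C ⊔ B := by
    refine le_antisymm (fun v hv => ?_) (sup_le hC inf_le_left)
    choose w hw using fun i => q.mkQ_surjective (v i)
    obtain rfl : (fun i => q.mkQ (w i)) = v := funext hw
    -- Minimality puts the coordinate in `m = I + J`; its `J`-part is itself a relation, since `J`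
    -- kills `A`.
    have hm := hmin w ((hφ w).symm.trans hv) i₀
    rw [← hsup] at hm
    obtain ⟨x, hx, y, hy, hxy⟩ := Submodule.mem_sup.mp hm
    have hy' : s (q.mkQ y) ∈ C := ⟨_, ⟨y, hy, rfl⟩, rfl⟩
    refine Submodule.mem_sup.mpr ⟨s (q.mkQ y), hy', (fun i => q.mkQ (w i)) - s (q.mkQ y),
      ⟨Submodule.sub_mem _ hv (hC hy'), x, hx, ?_⟩, add_sub_cancel _ _⟩
    simp only [LinearMap.proj_apply, Pi.sub_apply, s, LinearMap.single_apply, Pi.single_eq_same,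
      ← hxy, map_add, add_sub_cancel_right]
  have hC' : X (FGModuleCat.of R C) :=
    hX.of_sup hdisj (hX.of_linearEquiv (LinearEquiv.ofEq _ _ hCB) hK)
  exact hX.of_linearEquiv (Submodule.equivMapOfInjective s hs _).symm hC'

theorem IsThickSubcategory.residueField_of_smul_eq_zero [IsLocalRing R] (hX : IsThickSubcategory X)
    (hQ : X (FGModuleCat.of R (R ⧸ q))) (hinf : I ⊓ J = q) (hsup : I ⊔ J = maximalIdeal R)
    (hJq : ¬ J ≤ q) {A : Type u} [AddCommGroup A] [Module R A] [Module.Finite R A] [Nontrivial A]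
    (hJ : ∀ r ∈ J, ∀ a : A, r • a = 0) (hA : X (FGModuleCat.of R A)) :
    X (FGModuleCat.of R (R ⧸ maximalIdeal R)) := by
  have hqI : q ≤ I := hinf ▸ inf_le_left
  have hqJ : q ≤ J := hinf ▸ inf_le_right
  have h1 := hX.map_mkQ_of_smul_eq_zero hQ hinf hsup hJ hA
  have : Nontrivial (Submodule.map q.mkQ J) := by
    rw [Submodule.nontrivial_iff_ne_bot]
    intro h
    refine hJq fun r hr => (Submodule.Quotient.mk_eq_zero q).mp ?_
    exact (Submodule.mem_bot R).mp (h ▸ Submodule.mem_map_of_mem (f := q.mkQ) hr)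
  -- `J/q` is killed by `I`, because `IJ ⊆ I ∩ J = q`; the roles can be exchanged.
  have h2 := hX.map_mkQ_of_smul_eq_zero (I := J) (J := I) hQ (inf_comm I J ▸ hinf)
    (sup_comm I J ▸ hsup) (A := Submodule.map q.mkQ J) (by
      rintro r hr ⟨_, s, hs, rfl⟩
      apply Subtype.ext
      exact (Submodule.Quotient.mk_eq_zero q).mpr
        (hinf ▸ ⟨I.mul_mem_right s hr, J.mul_mem_left r hs⟩)) h1
  let φ : (Submodule.map q.mkQ I × Submodule.map q.mkQ J) →ₗ[R] R ⧸ q :=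
    (Submodule.subtype _).coprod (Submodule.subtype _)
  have hφ : Function.Injective φ := by
    rw [← LinearMap.ker_eq_bot, LinearMap.ker_eq_bot']
    rintro ⟨⟨_, r, hr, rfl⟩, ⟨_, s, hs, rfl⟩⟩ h
    have h0 : r + s ∈ q := (Submodule.Quotient.mk_eq_zero q).mp (by simpa [φ] using h)
    have hr' : r ∈ J := by simpa using J.sub_mem (hqJ h0) hs
    have hs' : s ∈ I := by simpa using I.sub_mem (hqI h0) hr
    ext
    · exact (Submodule.Quotient.mk_eq_zero q).mpr (hinf ▸ ⟨hr, hr'⟩)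
    · exact (Submodule.Quotient.mk_eq_zero q).mpr (hinf ▸ ⟨hs', hs⟩)
  have hqm : q ≤ maximalIdeal R := hsup ▸ hqI.trans le_sup_left
  refine hX.right_of_exact (f := φ) (g := Submodule.factor hqm) hφ ?_
    (Submodule.factor_surjective hqm) (hX.prod h2 h1) hQ
  rw [LinearMap.exact_iff]
  ext x
  obtain ⟨x, rfl⟩ := q.mkQ_surjective x
  have : x ∈ maximalIdeal R ↔ ∃ a ∈ I, ∃ b ∈ J, a + b = x := by rw [← hsup, Submodule.mem_sup]
  rw [LinearMap.mem_ker, Submodule.mkQ_apply]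
  refine (Submodule.Quotient.mk_eq_zero (maximalIdeal R)).trans (this.trans ?_)
  constructor
  · rintro ⟨a, ha, b, hb, rfl⟩
    exact ⟨(⟨_, a, ha, rfl⟩, ⟨_, b, hb, rfl⟩), rfl⟩
  · rintro ⟨⟨⟨_, a, ha, rfl⟩, ⟨_, b, hb, rfl⟩⟩, h⟩
    have h0 : (a + b) - x ∈ q := (Submodule.Quotient.eq q).mp h
    refine ⟨a - ((a + b) - x), I.sub_mem ha (hqI h0), b, hb, by ring⟩

/-- A nonzero submodule of the free module `(R ⧸ q)ⁿ` which decomposes along `m ⧸ q = I ⧸ q ⊕ J ⧸ q`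
generates the residue field. -/
theorem IsThickSubcategory.residueField_of_decomposition [IsLocalRing R]
    (hX : IsThickSubcategory X)
    (hQ : X (FGModuleCat.of R (R ⧸ q))) (hinf : I ⊓ J = q) (hsup : I ⊔ J = maximalIdeal R)
    (hIq : ¬ I ≤ q) (hJq : ¬ J ≤ q) {n : ℕ} (W : Submodule R (Fin n → R ⧸ q)) (hW : W ≠ ⊥)
    (hdec : ∀ w ∈ W, ∃ a ∈ W, ∃ b ∈ W, a + b = w ∧ (∀ i, a i ∈ Submodule.map q.mkQ I) ∧
      ∀ i, b i ∈ Submodule.map q.mkQ J) (hXW : X (FGModuleCat.of R W)) :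
    X (FGModuleCat.of R (R ⧸ maximalIdeal R)) := by
  let P : Ideal R → Submodule R (Fin n → R ⧸ q) := fun I =>
    Submodule.pi Set.univ fun _ => Submodule.map q.mkQ I
  have hPmem : ∀ (I : Ideal R) v, v ∈ P I ↔ ∀ i, v i ∈ Submodule.map q.mkQ I := by
    intro I v; simp [P, Submodule.mem_pi]
  have hkill : ∀ {I J : Ideal R}, I ⊓ J = q → ∀ r ∈ J, ∀ a : ↥(W ⊓ P I), r • a = 0 := by
    rintro I J h r hr ⟨a, -, ha⟩
    ext i
    obtain ⟨s, hs, hsa⟩ := (hPmem I a).mp ha i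
    change r • a i = 0
    rw [← hsa, ← map_smul]
    exact (Submodule.Quotient.mk_eq_zero q).mpr (h ▸ ⟨I.mul_mem_left r hs, J.mul_mem_right s hr⟩)
  have hdisj : Disjoint (W ⊓ P I) (W ⊓ P J) := by
    rw [Submodule.disjoint_def]
    rintro v ⟨-, hvI⟩ ⟨-, hvJ⟩
    ext i
    obtain ⟨r, hr, hrv⟩ := (hPmem I v).mp hvI i
    obtain ⟨s, hs, hsv⟩ := (hPmem J v).mp hvJ i
    have h2 : r - s ∈ q := (Submodule.Quotient.eq q).mp (hrv.trans hsv.symm)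
    have hqJ : q ≤ J := hinf ▸ inf_le_right
    have h3 : r ∈ J := by simpa using J.add_mem (hqJ h2) hs
    rw [← hrv]
    exact (Submodule.Quotient.mk_eq_zero q).mpr (hinf ▸ ⟨hr, h3⟩)
  have hsupW : W = (W ⊓ P I) ⊔ (W ⊓ P J) := by
    refine le_antisymm (fun w hw => ?_) (sup_le inf_le_left inf_le_left)
    obtain ⟨a, ha, b, hb, rfl, haI, hbJ⟩ := hdec w hw
    exact Submodule.add_mem_sup ⟨ha, (hPmem I a).mpr haI⟩ ⟨hb, (hPmem J b).mpr hbJ⟩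
  have hXW' := hX.of_linearEquiv (LinearEquiv.ofEq _ _ hsupW) hXW
  -- At least one of the two summands is nonzero, and either one suffices by symmetry.
  by_cases h : W ⊓ P I = ⊥
  · have : Nontrivial ↥(W ⊓ P J) := by
      rw [Submodule.nontrivial_iff_ne_bot]
      intro h'
      rw [h, h', sup_bot_eq] at hsupW
      exact hW hsupW
    exact hX.residueField_of_smul_eq_zero hQ (inf_comm I J ▸ hinf) (sup_comm I J ▸ hsup) hIq
      (hkill (inf_comm I J ▸ hinf))
      (hX.of_sup hdisj.symm (hX.of_linearEquiv (LinearEquiv.ofEq _ _ (sup_comm _ _)) hXW'))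
  · have : Nontrivial ↥(W ⊓ P I) := by rwa [Submodule.nontrivial_iff_ne_bot]
    exact hX.residueField_of_smul_eq_zero hQ hinf hsup hJq (hkill hinf) (hX.of_sup hdisj hXW')

end QuasiDecomposable

/-! ### Syzygies of a module of large projective dimension. -/

section Syzygy

open IsLocalRing RingTheory.Sequence

variable {R : Type u} [CommRing R]

theorem ModuleCat.hasProjectiveDimensionLT_ker_iff {M F : Type u} [AddCommGroup M] [Module R M]
    [AddCommGroup F] [Module R F] [Module.Projective R F] {π : F →ₗ[R] M}
    (hπ : Function.Surjective π) (n : ℕ) :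
    HasProjectiveDimensionLT (ModuleCat.of R M) (n + 2) ↔
      HasProjectiveDimensionLT (ModuleCat.of R (LinearMap.ker π)) (n + 1) :=
  (LinearMap.shortExact_shortComplexKer hπ).hasProjectiveDimensionLT_X₃_iff n
    (inferInstanceAs (Projective (ModuleCat.of R F)))

variable [IsNoetherianRing R] {X : ObjectProperty (FGModuleCat.{u} R)}

/-- Each syzygy extends the regular initial segment of `rs` by one element and uses up one unit of
projective dimension. -/
theorem IsThickSubcategory.exists_isWeaklyRegular (hX : IsThickSubcategory X)
    (hR : X (FGModuleCat.of R R)) {rs : List R} (hrs : IsWeaklyRegular R rs) (j : ℕ)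
    {M : Type u} [AddCommGroup M] [Module R M] [Module.Finite R M] (hM : X (FGModuleCat.of R M))
    (hpd : ¬ HasProjectiveDimensionLT (ModuleCat.of R M) (rs.length + j + 1)) :
    ∃ (N : Type u) (_ : AddCommGroup N) (_ : Module R N) (_ : Module.Finite R N),
      X (FGModuleCat.of R N) ∧ IsWeaklyRegular N rs ∧
        ¬ HasProjectiveDimensionLT (ModuleCat.of R N) (j + 1) := by
  induction rs using List.reverseRecOn generalizing j with
  | nil =>
    exact ⟨M, _, _, ‹_›, hM, .nil R M, by simpa using hpd⟩
  | append_singleton rs r ih =>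
    obtain ⟨N, _, _, _, hN, hreg, hpdN⟩ := ih hrs.of_append_left (j + 1) (by
      rw [List.length_append, List.length_singleton] at hpd
      rwa [← add_assoc, add_right_comm _ j 1])
    obtain ⟨n, π, hπ⟩ := Module.Finite.exists_fin' R N
    refine ⟨LinearMap.ker π, inferInstance, inferInstance, inferInstance,
      hX.ker hπ (hX.pi_fin hR n) hN, ?_, ?_⟩
    · exact hreg.concat_of_exact (by simp) (hrs.pi_fin n) (LinearMap.ker π).injective_subtype
        (LinearMap.exact_subtype_ker_map π) hπ
    · rwa [← ModuleCat.hasProjectiveDimensionLT_ker_iff hπ]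

theorem IsThickSubcategory.residueField_of_isQuasiDecomposableWith [IsLocalRing R]
    (hX : IsThickSubcategory X) (hR : X (FGModuleCat.of R R)) {xs : List R}
    (hxs : IsQuasiDecomposableWith R xs) {M : Type u} [AddCommGroup M] [Module R M]
    [Module.Finite R M] (hM : X (FGModuleCat.of R M))
    (hpd : ¬ HasProjectiveDimensionLT (ModuleCat.of R M) (xs.length + 2)) :
    X (FGModuleCat.of R (R ⧸ maximalIdeal R)) := by
  have hreg : IsWeaklyRegular R xs := hxs.isRegular.toIsWeaklyRegular
  obtain ⟨I, J, hinf, hsup, hIq, hJq⟩ :=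
    Ideal.exists_inf_sup_of_isDecomposableModule hxs.ofList_le hxs.isDecomposable
  have hqm := hxs.ofList_le
  -- Here `j = 1` leaves `pd L ≥ 2`, exactly what keeps the second syzygy `ker φ` nonzero.
  obtain ⟨L, _, _, _, hL, hregL, hpdL⟩ := hX.exists_isWeaklyRegular hR hreg 1 hM hpd
  obtain ⟨t, π, hπ⟩ := Module.Finite.exists_fin' R L
  have hexN := LinearMap.exact_subtype_ker_map π
  have hinjN := (LinearMap.ker π).injective_subtype
  have hXN := hX.ker hπ (hX.pi_fin hR t) hL
  rw [ModuleCat.hasProjectiveDimensionLT_ker_iff hπ 0] at hpdL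
  obtain ⟨s, φ, hφ, hmin⟩ := exists_minimal_cover R (LinearMap.ker π)
  have hexK := LinearMap.exact_subtype_ker_map φ
  have hinjK := (LinearMap.ker φ).injective_subtype
  have hXK := hX.ker hφ (hX.pi_fin hR s) hXN
  have hregN : IsWeaklyRegular (LinearMap.ker π) xs := by
    simpa using hregL.concat_of_exact (ss := []) (by simp) (by simpa using hreg.pi_fin t)
      hinjN hexN hπ
  have hregK : IsWeaklyRegular (LinearMap.ker φ) xs := by
    simpa using hregN.concat_of_exact (ss := []) (by simp) (by simpa using hreg.pi_fin s)
      hinjK hexK hφ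
  have hK : Nontrivial (LinearMap.ker φ) := by
    rw [Submodule.nontrivial_iff_ne_bot]
    intro h
    refine hpdL ?_
    have : Module.Projective R (LinearMap.ker π) :=
      .of_equiv (LinearEquiv.ofBijective φ ⟨LinearMap.ker_eq_bot.mp h, hφ⟩)
    infer_instance
  have hXQ : X (FGModuleCat.of R (R ⧸ Ideal.ofList xs)) :=
    hX.of_linearEquiv (Submodule.quotEquivOfEq _ _ (by simp)) (hX.quotient_ofList hR hreg)
  have hXK' := hX.quotient_ofList hXK hregK
  generalize hq : Ideal.ofList xs = q at *
  let ρ : (Fin s → R) →ₗ[R] (Fin s → R ⧸ q) := LinearMap.pi fun i => q.mkQ ∘ₗ LinearMap.proj i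
  have hρ : ∀ v, ρ v = 0 ↔ v ∈ q • (⊤ : Submodule R (Fin s → R)) := by
    intro v
    rw [Ideal.mem_smul_top_pi_iff, funext_iff]
    exact forall_congr' fun i => Submodule.Quotient.mk_eq_zero q
  let σ : LinearMap.ker φ →ₗ[R] (Fin s → R ⧸ q) := ρ ∘ₗ (LinearMap.ker φ).subtype
  -- Regularity on `ker π` makes `K/qK → (R/q)^s` injective, where `K = ker φ`.
  have hσ : LinearMap.ker σ = q • ⊤ := by
    ext k
    rw [LinearMap.mem_ker, LinearMap.comp_apply, hρ]
    refine ⟨fun h => ?_, fun h => Submodule.smul_top_le_comap_smul_top q _ h⟩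
    rw [← hq] at h ⊢
    exact hregN.mem_smul_top_of_exact hinjK hexK hφ h
  refine hX.residueField_of_decomposition (W := LinearMap.range σ) hXQ hinf hsup hIq hJq ?_ ?_
    (hX.of_linearEquiv ((Submodule.quotEquivOfEq _ _ hσ.symm).trans σ.quotKerEquivRange) hXK')
  · intro h
    rw [LinearMap.range_eq_bot] at h
    rw [h, LinearMap.ker_zero] at hσ
    refine top_ne_bot (Submodule.eq_bot_of_le_smul_of_le_jacobson_bot q
      (⊤ : Submodule R (LinearMap.ker φ)) Module.Finite.fg_top hσ.le ?_)
    rwa [jacobson_eq_maximalIdeal ⊥ bot_ne_top]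
  · rintro _ ⟨⟨k, hk⟩, rfl⟩
    have hm := hmin k hk
    choose a ha b hb hab using fun i => Submodule.mem_sup.mp (hsup ▸ hm i : k i ∈ I ⊔ J)
    obtain rfl : a + b = k := funext hab
    have hφab : φ a + φ b = 0 := by rw [← map_add]; exact hk
    have hmem : ∀ (P : Ideal R) (c : Fin s → R), (∀ i, c i ∈ P) →
        ∀ i, (φ c : Fin t → R) i ∈ P := by
      intro P c hc
      rw [← Ideal.mem_smul_top_pi_iff]
      exact Submodule.smul_top_le_comap_smul_top P ((LinearMap.ker π).subtype ∘ₗ φ)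
        ((Ideal.mem_smul_top_pi_iff P c).mpr hc)
    -- `φ a = -φ b` has entries in both `I` and `J`, hence in `q`.
    have h1 : ((LinearMap.ker π).subtype (φ a)) ∈ q • (⊤ : Submodule R (Fin t → R)) := by
      rw [Ideal.mem_smul_top_pi_iff]
      intro i
      have hJ : (φ a : Fin t → R) i ∈ J := by
        have h2 : (φ a : Fin t → R) i = -(φ b : Fin t → R) i := by
          rw [eq_neg_of_add_eq_zero_left hφab]; rfl
        rw [h2]
        exact J.neg_mem (hmem J b hb i)
      exact hinf ▸ ⟨hmem I a ha i, hJ⟩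
    have h3 : φ a ∈ q • (⊤ : Submodule R (LinearMap.ker π)) := by
      rw [← hq] at h1 ⊢
      exact hregL.mem_smul_top_of_exact hinjN hexN hπ h1
    rw [← LinearMap.range_eq_top.mpr hφ, LinearMap.range_eq_map, ← Submodule.map_smul''] at h3
    -- The correction term: `a - g` and `b + g` lie in `ker φ` and agree with `a` and `b` modulo
    -- `q`.
    obtain ⟨g, hg, hga⟩ := h3
    have hg0 : ρ g = 0 := (hρ g).mpr hg
    have hag : a - g ∈ LinearMap.ker φ := by rw [LinearMap.mem_ker, map_sub, hga, sub_self]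
    have hbg : b + g ∈ LinearMap.ker φ := by
      rw [LinearMap.mem_ker, map_add, hga, add_comm, hφab]
    refine ⟨ρ a, ⟨⟨a - g, hag⟩, ?_⟩, ρ b, ⟨⟨b + g, hbg⟩, ?_⟩, (map_add ρ a b).symm,
      fun i => ⟨a i, ha i, rfl⟩, fun i => ⟨b i, hb i, rfl⟩⟩
    · change ρ (a - g) = ρ a
      rw [map_sub, hg0, sub_zero]
    · change ρ (b + g) = ρ b
      rw [map_add, hg0, add_zero]

end Syzygy

/-! ### Finite projective dimension of the residue field of a regular local ring. -/

section RegularLocalRing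

open IsLocalRing RingTheory.Sequence

theorem IsLocalRing.ringKrullDim_le_length {R : Type*} [CommRing R] [IsNoetherianRing R]
    [IsLocalRing R] {rs : List R} (h : Ideal.ofList rs = maximalIdeal R) :
    ringKrullDim R ≤ rs.length := by
  classical
  refine (ringKrullDim_le_spanFinrank_maximalIdeal R).trans ?_
  have h1 : (maximalIdeal R).spanFinrank ≤ {r | r ∈ rs}.ncard := by
    rw [← h]
    exact Submodule.spanFinrank_span_le_ncard_of_finite rs.finite_toSet
  have h2 : {r | r ∈ rs}.ncard ≤ rs.length := by
    rw [← List.coe_toFinset, Set.ncard_coe_finset]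
    exact rs.toFinset_card_le
  exact_mod_cast h1.trans h2

theorem IsLocalRing.ringKrullDim_le_quotient_span_singleton_add_one {R : Type*} [CommRing R]
    [IsNoetherianRing R] [IsLocalRing R] {x : R} (hx : x ∈ maximalIdeal R) :
    ringKrullDim R ≤ ringKrullDim (R ⧸ Ideal.span {x}) + 1 := by
  rw [← maximalIdeal_height_eq_ringKrullDim]
  exact Ideal.height_le_ringKrullDim_quotient_add_one hx

theorem exists_isPrime_le_ringKrullDim_quotient {R : Type*} [CommRing R] {n : ℕ}
    (h : (n : WithBot ℕ∞) ≤ ringKrullDim R) :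
    ∃ P : Ideal R, P.IsPrime ∧ (n : WithBot ℕ∞) ≤ ringKrullDim (R ⧸ P) := by
  obtain ⟨l, rfl⟩ := Order.le_krullDim_iff.mp h
  refine ⟨l.head.asIdeal, l.head.isPrime, ?_⟩
  rw [ringKrullDim_quotient, Order.le_krullDim_iff]
  exact ⟨⟨l.length, fun i => ⟨l i, l.head_le i⟩, fun i => l.step i⟩, rfl⟩

theorem IsLocalRing.map_mk_maximalIdeal {R : Type*} [CommRing R] [IsLocalRing R] (I : Ideal R)
    [IsLocalRing (R ⧸ I)] : (maximalIdeal R).map (Ideal.Quotient.mk I) = maximalIdeal (R ⧸ I) :=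
  map_maximalIdeal_of_surjective _ Ideal.Quotient.mk_surjective

/-- If the maximal ideal of a Noetherian local ring `R` is generated by `dim R` elements, then `R`
is a domain and these elements form a regular sequence. -/
theorem IsLocalRing.isDomain_and_isWeaklyRegular_of_length_le {R : Type u} [CommRing R]
    [IsNoetherianRing R] [IsLocalRing R] {rs : List R} (h : Ideal.ofList rs = maximalIdeal R)
    (hd : (rs.length : WithBot ℕ∞) ≤ ringKrullDim R) : IsDomain R ∧ IsWeaklyRegular R rs := by
  generalize hn : rs.length = n at hd
  induction n generalizing R with
  | zero =>
    obtain rfl := List.length_eq_zero_iff.mp hn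
    rw [Ideal.ofList_nil] at h
    exact ⟨(isField_iff_maximalIdeal_eq.mpr h.symm).isDomain, .nil R R⟩
  | succ d ih =>
    obtain ⟨x, rs, rfl⟩ := List.exists_cons_of_length_eq_add_one hn
    rw [List.length_cons, add_left_inj] at hn
    push_cast at hd
    have hx : x ∈ maximalIdeal R := h ▸ Ideal.subset_span (by simp)
    have hne : Ideal.span {x} ≠ ⊤ := fun h' =>
      (maximalIdeal.isMaximal R).ne_top (top_le_iff.mp (h' ▸ (Ideal.span_singleton_le_iff_mem _).mpr hx))
    have : Nontrivial (R ⧸ Ideal.span {x}) := Ideal.Quotient.nontrivial_iff.mpr hne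
    have : IsLocalRing (R ⧸ Ideal.span {x}) := .of_surjective' _ Ideal.Quotient.mk_surjective
    have hmap : ∀ (I : Ideal R) [IsLocalRing (R ⧸ I)], x ∈ I →
        Ideal.ofList (rs.map (Ideal.Quotient.mk I)) = maximalIdeal (R ⧸ I) := by
      intro I _ hxI
      rw [← map_mk_maximalIdeal, ← h, Ideal.map_ofList, List.map_cons, Ideal.ofList_cons,
        Ideal.Quotient.eq_zero_iff_mem.mpr hxI]
      simp
    have hA := hmap _ (Ideal.mem_span_singleton_self x)
    obtain ⟨hdom, hreg⟩ := ih hA (by simpa using hn) (by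
      have := hd.trans (ringKrullDim_le_quotient_span_singleton_add_one hx)
      exact (ENat.WithBot.add_le_add_one_right_iff).mp this)
    have hdimA := ringKrullDim_le_length hA
    rw [List.length_map, hn] at hdimA
    -- `P` starts a chain of primes of length `d + 1`; the aim is `P = 0`. If `x ∈ P`, then `d`
    -- elements would generate the maximal ideal of `R/P`, which is too few.
    obtain ⟨P, hP, hPd⟩ := exists_isPrime_le_ringKrullDim_quotient (n := d + 1) (by exact_mod_cast hd)
    have : IsLocalRing (R ⧸ P) := .of_surjective' _ Ideal.Quotient.mk_surjective
    have hxP : x ∉ P := by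
      intro hxP
      have := hPd.trans (ringKrullDim_le_length (hmap P hxP))
      rw [List.length_map, hn] at this
      norm_cast at this
      omega
    -- An element of `P` outside `(x)` is a nonzerodivisor on the domain `R/(x)`, so `dim R/(P +
    -- (x)) + 1 ≤ d`, contradicting `dim R/P ≥ d + 1`.
    have hPx : P ≤ Ideal.span {x} := by
      intro y hy
      by_contra hyx
      let x' := Ideal.Quotient.mk P x
      have hx' : x' ∈ maximalIdeal (R ⧸ P) := by
        rw [← map_mk_maximalIdeal]
        exact Ideal.mem_map_of_mem _ hx
      let f : R ⧸ Ideal.span {x} →+* (R ⧸ P) ⧸ Ideal.span {x'} :=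
        Ideal.Quotient.lift _ ((Ideal.Quotient.mk _).comp (Ideal.Quotient.mk P)) (by
          intro a ha
          obtain ⟨b, rfl⟩ := Ideal.mem_span_singleton.mp ha
          rw [RingHom.comp_apply, Ideal.Quotient.eq_zero_iff_mem, map_mul]
          exact Ideal.mul_mem_right _ _ (Ideal.mem_span_singleton_self x'))
      have hf : Function.Surjective f := Ideal.Quotient.lift_surjective_of_surjective _ _
        (Ideal.Quotient.mk_surjective.comp Ideal.Quotient.mk_surjective)
      have h1 := ringKrullDim_succ_le_of_surjective f hf (r := Ideal.Quotient.mk _ y)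
        (mem_nonZeroDivisors_of_ne_zero (by rwa [Ne, Ideal.Quotient.eq_zero_iff_mem]))
        (by simp [f, Ideal.Quotient.eq_zero_iff_mem.mpr hy])
      have h2 := hPd.trans ((ringKrullDim_le_quotient_span_singleton_add_one hx').trans
        (h1.trans hdimA))
      norm_cast at h2
      omega
    -- Since `P ⊆ (x)` and `x ∉ P`, primeness gives `P = xP`; Nakayama applies.
    have hPbot : P = ⊥ := by
      refine Submodule.eq_bot_of_le_smul_of_le_jacobson_bot (Ideal.span {x}) P
        (IsNoetherian.noetherian P) (fun y hy => ?_) ?_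
      · obtain ⟨z, rfl⟩ := Ideal.mem_span_singleton.mp (hPx hy)
        exact Submodule.smul_mem_smul (Ideal.mem_span_singleton_self x)
          ((hP.mem_or_mem hy).resolve_left hxP)
      · rw [jacobson_eq_maximalIdeal ⊥ bot_ne_top]
        exact (Ideal.span_singleton_le_iff_mem _).mpr hx
    subst hPbot
    have hR : IsDomain R := IsDomain.of_bot_isPrime R
    refine ⟨hR, ?_⟩
    rw [isWeaklyRegular_cons_iff]
    refine ⟨(IsLeftRegular.isSMulRegular (IsLeftCancelMulZero.mul_left_cancel_of_ne_zero hxP)), ?_⟩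
    rw [← Ideal.Quotient.algebraMap_eq, isWeaklyRegular_map_algebraMap_iff] at hreg
    refine (LinearEquiv.isWeaklyRegular_congr (Submodule.quotEquivOfEq _ _ ?_) rs).mp hreg
    rw [← Submodule.ideal_span_singleton_smul]
    simp

theorem IsRegularLocalRing.exists_hasProjectiveDimensionLT_quotient_maximalIdeal (R : Type u)
    [CommRing R] [IsRegularLocalRing R] :
    ∃ n, HasProjectiveDimensionLT (ModuleCat.of R (R ⧸ maximalIdeal R)) n := by
  obtain ⟨s, hs, hspan⟩ :=
    Submodule.FG.exists_span_finset_card_eq_spanFinrank (IsNoetherian.noetherian (maximalIdeal R))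
  have hgen : Ideal.ofList s.toList = maximalIdeal R := by
    rw [Ideal.ofList, ← hspan]
    congr 1
    ext; simp
  have hreg := (isDomain_and_isWeaklyRegular_of_length_le hgen (by
    rw [Finset.length_toList, hs, IsRegularLocalRing.spanFinrank_maximalIdeal])).2
  have h := ModuleCat.projectiveDimension_quotient_eq_add_length_of_isWeaklyRegular
    (ModuleCat.of R R) s.toList hreg (fun r hr => hgen ▸ Ideal.subset_span hr)
  have h1 : projectiveDimension (ModuleCat.of R (R ⧸ maximalIdeal R)) ≠ ⊤ := by
    rw [← projectiveDimension_eq_of_iso (Submodule.quotEquivOfEq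
      (Ideal.ofList s.toList • (⊤ : Submodule R R)) (maximalIdeal R) (by simp [hgen])).toModuleIso, h,
      ModuleCat.projectiveDimension_eq_zero_of_projective, zero_add]
    exact fun h' => ENat.natCast_ne_top _ (WithBot.coe_injective h')
  obtain ⟨n, hn⟩ := (projectiveDimension_ne_top_iff _).mp h1
  exact ⟨n + 1, hn⟩

end RegularLocalRing

/-! ### Isolated singularities: generation by `R` and the residue field. -/

section IsolatedSingularity

open IsLocalRing

variable {R : Type u} [CommRing R]

/-- The localized cover splits; clearing denominators in a splitting costs a factor `s ∈ S`. -/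
theorem Module.Projective.exists_smul_factors_of_isLocalizedModule [IsNoetherianRing R]
    (S : Submonoid R) {N Nₛ : Type*}
    [AddCommGroup N] [Module R N] [Module.Finite R N] [AddCommGroup Nₛ] [Module R Nₛ]
    [Module (Localization S) Nₛ] [IsScalarTower R (Localization S) Nₛ] (f : N →ₗ[R] Nₛ)
    [IsLocalizedModule S f] [Module.Projective (Localization S) Nₛ] {n : ℕ}
    {π : (Fin n → R) →ₗ[R] N} (hπ : Function.Surjective π) :
    ∃ s ∈ S, ∃ h : N →ₗ[R] (Fin n → R), ∀ x, π (h x) = s • x := by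
  have : Module.FinitePresentation R N := Module.finitePresentation_of_finite R N
  let g := LocalizedModule.mkLinearMap S (Fin n → R)
  let πₛ := IsLocalizedModule.mapExtendScalars S g f (Localization S) π
  have hπₛ : Function.Surjective πₛ := IsLocalizedModule.map_surjective S g f π hπ
  obtain ⟨σ, hσ⟩ := Module.projective_lifting_property πₛ LinearMap.id hπₛ
  obtain ⟨h, s, hs⟩ := Module.FinitePresentation.exists_lift_of_isLocalizedModule S g
    (σ.restrictScalars R ∘ₗ f)
  have key : f ∘ₗ (π ∘ₗ h) = f ∘ₗ ((s : R) • LinearMap.id) := by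
    ext x
    have h1 : πₛ (g (h x)) = f (π (h x)) := IsLocalizedModule.map_apply S g f π (h x)
    have h2 : g (h x) = (s : R) • σ (f x) := LinearMap.congr_fun hs x
    have h3 : πₛ (σ (f x)) = f x := LinearMap.congr_fun hσ (f x)
    simp only [LinearMap.comp_apply, LinearMap.smul_apply, LinearMap.id_apply, map_smul]
    rw [← h1, h2, LinearMap.map_smul_of_tower, h3]
  obtain ⟨c, hc⟩ := Module.Finite.exists_smul_of_comp_eq_of_isLocalizedModule S f _ _ key
  refine ⟨c * s, S.mul_mem c.2 s.2, (c : R) • h, fun x => ?_⟩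
  have := LinearMap.congr_fun hc x
  rw [LinearMap.smul_apply, map_smul, mul_smul]
  exact this

theorem ModuleCat.exists_hasProjectiveDimensionLE_localizedModule_quotient (p : Ideal R)
    [p.IsPrime] [IsRegularLocalRing (Localization.AtPrime p)] :
    ∃ j, HasProjectiveDimensionLE ((ModuleCat.of R (R ⧸ p)).localizedModule p.primeCompl) j := by
  obtain ⟨n, hn⟩ := IsRegularLocalRing.exists_hasProjectiveDimensionLT_quotient_maximalIdeal
    (Localization.AtPrime p)
  refine ⟨n, ?_⟩
  let Rₚ := Localization.AtPrime p
  let f := Algebra.linearMap R Rₚ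
  have hloc : p.localized' Rₚ p.primeCompl f = maximalIdeal Rₚ := by
    rw [← Localization.AtPrime.map_eq_maximalIdeal]
    exact Ideal.localized'_eq_map Rₚ p.primeCompl p
  have : IsLocalizedModule p.primeCompl
      ((ModuleCat.of R (R ⧸ p)).localizedModuleMkLinearMap p.primeCompl) :=
    ModuleCat.localizedModule_isLocalizedModule _ _
  let e := (Submodule.quotEquivOfEq _ _ hloc.symm).trans
    ((IsLocalizedModule.linearEquiv p.primeCompl (p.toLocalizedQuotient' Rₚ p.primeCompl f)
      ((ModuleCat.of R (R ⧸ p)).localizedModuleMkLinearMap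
        p.primeCompl)).extendScalarsOfIsLocalization p.primeCompl Rₚ)
  have : HasProjectiveDimensionLE (ModuleCat.of Rₚ (Rₚ ⧸ maximalIdeal Rₚ)) n :=
    hasProjectiveDimensionLT_of_ge _ n (n + 1) n.le_succ
  exact ModuleCat.hasProjectiveDimensionLE_of_linearEquiv
    (M := ModuleCat.of Rₚ (Rₚ ⧸ maximalIdeal Rₚ)) e n

variable [IsNoetherianRing R] {X : ObjectProperty (FGModuleCat.{u} R)}

/-- The kernel of `(x, y) ↦ t x + π y`, a representative of the shifted cone of multiplication
by `t`. -/
abbrev smulCocone {R : Type u} [CommRing R] {N F : Type u} [AddCommGroup N] [Module R N]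
    [AddCommGroup F] [Module R F] (t : R) (π : F →ₗ[R] N) : Submodule R (N × F) :=
  LinearMap.ker ((t • LinearMap.id).coprod π)

/-- When `t` factors through `π`, the map `x ↦ (x, -τ x)` splits the first projection from the
cocone. -/
theorem IsThickSubcategory.of_smulCocone_of_factors (hX : IsThickSubcategory X) {N F : Type u}
    [AddCommGroup N] [Module R N] [Module.Finite R N] [AddCommGroup F] [Module R F]
    [Module.Finite R F] {t : R} {π : F →ₗ[R] N} {τ : N →ₗ[R] F} (hτ : ∀ x, π (τ x) = t • x)
    (h : X (FGModuleCat.of R (smulCocone t π))) : X (FGModuleCat.of R N) :=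
  hX.of_linearRetract
    (LinearMap.codRestrict _ (LinearMap.id.prod (-τ)) fun x => by simp [hτ])
    (LinearMap.fst R N F ∘ₗ Submodule.subtype _) (by ext; rfl) h

/-- A horseshoe argument: the covers `ψ` and `π` combine to a cover `χ` of `E`, and the cocones of
`t` on `ker ρ`, `E`, `N` form a short exact sequence. -/
theorem IsThickSubcategory.smulCocone_ker (hX : IsThickSubcategory X) {N E F G : Type u}
    [AddCommGroup N] [Module R N] [Module.Finite R N] [AddCommGroup E] [Module R E]
    [Module.Finite R E] [AddCommGroup F] [Module R F] [Module.Finite R F] [Module.Projective R F]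
    [AddCommGroup G] [Module R G] [Module.Finite R G]
    (hE : X (FGModuleCat.of R E)) (hF : X (FGModuleCat.of R F)) (hG : X (FGModuleCat.of R G))
    {t : R} {π : F →ₗ[R] N} (hπ : Function.Surjective π) {ρ : E →ₗ[R] N}
    (hρ : Function.Surjective ρ) {ψ : G →ₗ[R] LinearMap.ker ρ} (hψ : Function.Surjective ψ)
    (h : X (FGModuleCat.of R (smulCocone t π))) : X (FGModuleCat.of R (smulCocone t ψ)) := by
  obtain ⟨l, hl⟩ := Module.projective_lifting_property ρ π hρ
  have hl' : ∀ y, ρ (l y) = π y := LinearMap.congr_fun hl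
  let χ : (G × F) →ₗ[R] E := ((LinearMap.ker ρ).subtype ∘ₗ ψ).coprod l
  have hχ : ∀ z, χ z = ψ z.1 + l z.2 := fun _ => rfl
  have hχs : Function.Surjective χ := by
    intro e
    obtain ⟨y, hy⟩ := hπ (ρ e)
    obtain ⟨z, hz⟩ := hψ ⟨e - l y, by rw [LinearMap.mem_ker, map_sub, hl', hy, sub_self]⟩
    exact ⟨(z, y), by rw [hχ, hz]; exact sub_add_cancel _ _⟩
  have hcs : Function.Surjective ((t • LinearMap.id (R := R) (M := E)).coprod χ) := fun e => by
    obtain ⟨z, hz⟩ := hχs e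
    exact ⟨(0, z), by simp [hz]⟩
  have hXE : X (FGModuleCat.of R (smulCocone t χ)) := hX.ker hcs (hX.prod hE (hX.prod hG hF)) hE
  let i : smulCocone t ψ →ₗ[R] smulCocone t χ :=
    LinearMap.restrict ((LinearMap.ker ρ).subtype.prodMap (LinearMap.inl R G F)) (by
      rintro ⟨x, z⟩ hx
      have := congrArg Subtype.val (LinearMap.mem_ker.mp hx)
      simpa [hχ] using this)
  let p : smulCocone t χ →ₗ[R] smulCocone t π :=
    LinearMap.restrict (ρ.prodMap (LinearMap.snd R G F)) (by
      rintro ⟨e, z, y⟩ he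
      have := congrArg ρ (LinearMap.mem_ker.mp he)
      simpa [hχ, hl'] using this)
  refine hX.left_of_exact (f := i) (g := p) ?_ ?_ ?_ hXE h
  · rintro ⟨⟨x, z⟩, hx⟩ ⟨⟨x', z'⟩, hx'⟩ hxx
    have h1 := congrArg (fun w : smulCocone t χ => w.1.1) hxx
    have h2 := congrArg (fun w : smulCocone t χ => w.1.2.1) hxx
    exact Subtype.ext (Prod.ext (Subtype.ext h1) h2)
  · rintro ⟨⟨e, z, y⟩, he⟩
    constructor
    · intro h0
      have h1 : ρ e = 0 := congrArg (fun w : smulCocone t π => w.1.1) h0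
      obtain rfl : y = 0 := congrArg (fun w : smulCocone t π => w.1.2) h0
      refine ⟨⟨(⟨e, h1⟩, z), ?_⟩, rfl⟩
      have := LinearMap.mem_ker.mp he
      rw [LinearMap.mem_ker]
      apply Subtype.ext
      simpa [hχ] using this
    · rintro ⟨⟨⟨x, z'⟩, hx⟩, h1⟩
      have h2 : (x : E) = e := congrArg (fun w : smulCocone t χ => w.1.1) h1
      have h3 : (0 : F) = y := congrArg (fun w : smulCocone t χ => w.1.2.2) h1
      subst h2 h3
      exact Subtype.ext (Prod.ext x.2 rfl)
  · rintro ⟨⟨x, y⟩, hx⟩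
    obtain ⟨e, rfl⟩ := hρ x
    have h1 : t • ρ e + π y = 0 := hx
    have h2 : -(t • e + l y) ∈ LinearMap.ker ρ := by
      rw [LinearMap.mem_ker, map_neg, map_add, map_smul, hl', h1, neg_zero]
    obtain ⟨z, hz⟩ := hψ ⟨_, h2⟩
    refine ⟨⟨(e, z, y), ?_⟩, rfl⟩
    rw [LinearMap.mem_ker, LinearMap.coprod_apply, hχ, hz]
    simp only [LinearMap.smul_apply, LinearMap.id_apply]
    abel

/-- Induction on the local projective dimension: if `N_p` is projective, a multiple of `s` factors
through any free cover; otherwise the claim passes to a syzygy. -/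
theorem IsThickSubcategory.exists_of_smulCocone (hX : IsThickSubcategory X)
    (hR : X (FGModuleCat.of R R)) (p : Ideal R) [p.IsPrime] (j : ℕ) {N : Type u} [AddCommGroup N]
    [Module R N] [Module.Finite R N]
    (hN : HasProjectiveDimensionLE ((ModuleCat.of R N).localizedModule p.primeCompl) j) :
    ∃ s ∉ p, ∀ (t : R), s ∣ t → ∀ (n : ℕ) (π : (Fin n → R) →ₗ[R] N), Function.Surjective π →
      X (FGModuleCat.of R (smulCocone t π)) → X (FGModuleCat.of R N) := by
  induction j generalizing N with
  | zero =>
    rw [← projective_iff_hasProjectiveDimensionLE_zero, ← IsProjective.iff_projective] at hN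
    obtain ⟨m, ρ, hρ⟩ := Module.Finite.exists_fin' R N
    have : IsLocalizedModule p.primeCompl
        ((ModuleCat.of R N).localizedModuleMkLinearMap p.primeCompl) :=
      ModuleCat.localizedModule_isLocalizedModule _ _
    obtain ⟨s, hs, h, hh⟩ := Module.Projective.exists_smul_factors_of_isLocalizedModule
      p.primeCompl ((ModuleCat.of R N).localizedModuleMkLinearMap p.primeCompl) hρ
    refine ⟨s, hs, ?_⟩
    rintro _ ⟨r, rfl⟩ n π hπ hXπ
    obtain ⟨l, hl⟩ := Module.projective_lifting_property π ρ hπ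
    refine hX.of_smulCocone_of_factors (τ := r • l ∘ₗ h) (fun x => ?_) hXπ
    have h1 : π (l (h x)) = ρ (h x) := LinearMap.congr_fun hl (h x)
    rw [LinearMap.smul_apply, LinearMap.comp_apply, map_smul, h1, hh, smul_smul, mul_comm]
  | succ j ih =>
    obtain ⟨m, ρ, hρ⟩ := Module.Finite.exists_fin' R N
    let T := ρ.shortComplexKer
    have hT : T.ShortExact := LinearMap.shortExact_shortComplexKer hρ
    have hTp := hT.map_of_exact (ModuleCat.localizedModuleFunctor p.primeCompl)
    have hproj : Projective (ModuleCat.of R (Fin m → R)) := inferInstance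
    obtain ⟨s, hs, h⟩ := ih (N := LinearMap.ker ρ)
      ((hTp.hasProjectiveDimensionLT_X₃_iff j
        ((ModuleCat.localizedModuleFunctor.{u} p.primeCompl).projective_obj_of_projective hproj)).mp hN)
    refine ⟨s, hs, fun t ht n π hπ hXπ => ?_⟩
    obtain ⟨k, ψ, hψ⟩ := Module.Finite.exists_fin' R (LinearMap.ker ρ)
    exact hX.of_surjective hρ (h t ht k ψ hψ (hX.smulCocone_ker (hX.pi_fin hR m) (hX.pi_fin hR n)
      (hX.pi_fin hR k) hπ hρ hψ hXπ)) (hX.pi_fin hR m)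

/-- For `N = R/p` covered by `R`, the cocone of `s` is `{(x, y) : sx + y ∈ p}`. As `s ∉ p`, `y`
determines `x`, and `y` runs through `p + (s)`. -/
theorem IsThickSubcategory.quotient_prime (hX : IsThickSubcategory X)
    (hR : X (FGModuleCat.of R R)) (p : Ideal R) [p.IsPrime]
    [IsRegularLocalRing (Localization.AtPrime p)]
    (h : ∀ a : Ideal R, p < a → X (FGModuleCat.of R (R ⧸ a))) : X (FGModuleCat.of R (R ⧸ p)) := by
  obtain ⟨j, hj⟩ := ModuleCat.exists_hasProjectiveDimensionLE_localizedModule_quotient p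
  obtain ⟨s, hs, hs'⟩ := hX.exists_of_smulCocone hR p j hj
  let ρ : (Fin 1 → R) →ₗ[R] (R ⧸ p) := p.mkQ ∘ₗ LinearMap.proj 0
  have hρ : Function.Surjective ρ := p.mkQ_surjective.comp fun r => ⟨fun _ => r, rfl⟩
  refine hs' s dvd_rfl 1 ρ hρ ?_
  let a := p ⊔ Ideal.span {s}
  have hpa : p < a := lt_of_le_of_ne le_sup_left fun h => hs (h ▸ Ideal.mem_sup_right
    (Ideal.mem_span_singleton_self s))
  have hXa : X (FGModuleCat.of R a) := hX.left_of_exact a.injective_subtype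
    (LinearMap.exact_subtype_mkQ a) a.mkQ_surjective hR (h a hpa)
  let φ : smulCocone s ρ →ₗ[R] a :=
    LinearMap.codRestrict _ (LinearMap.proj 0 ∘ₗ LinearMap.snd R _ _ ∘ₗ Submodule.subtype _) (by
      rintro ⟨⟨x, y⟩, hx⟩
      obtain ⟨x, rfl⟩ := p.mkQ_surjective x
      have h1 : s * x + y 0 ∈ p := (Submodule.Quotient.mk_eq_zero p).mp hx
      have h2 : y 0 = (s * x + y 0) - s * x := by ring
      change y 0 ∈ a
      rw [h2]
      exact a.sub_mem (Ideal.mem_sup_left h1)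
        (Ideal.mem_sup_right (Ideal.mul_mem_right _ _ (Ideal.mem_span_singleton_self s))))
  have hφ : Function.Bijective φ := by
    constructor
    · rw [← LinearMap.ker_eq_bot, LinearMap.ker_eq_bot']
      rintro ⟨⟨x, y⟩, hx⟩ h0
      obtain ⟨x, rfl⟩ := p.mkQ_surjective x
      have h1 : s * x + y 0 ∈ p := (Submodule.Quotient.mk_eq_zero p).mp hx
      have hy : y 0 = 0 := congrArg Subtype.val h0
      rw [hy, add_zero] at h1
      have h2 : x ∈ p := (Ideal.IsPrime.mem_or_mem ‹_› h1).resolve_left hs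
      refine Subtype.ext (Prod.ext ((Submodule.Quotient.mk_eq_zero p).mpr h2) ?_)
      ext i
      rw [Subsingleton.elim i 0]
      exact hy
    · rintro ⟨y, hy⟩
      obtain ⟨b, hb, c, hc, rfl⟩ := Submodule.mem_sup.mp hy
      obtain ⟨r, rfl⟩ := Ideal.mem_span_singleton.mp hc
      refine ⟨⟨(p.mkQ (-r), fun _ => b + s * r), ?_⟩, rfl⟩
      refine (Submodule.Quotient.mk_eq_zero p).mpr ?_
      change s * -r + (b + s * r) ∈ p
      rwa [show s * -r + (b + s * r) = b by ring]
  exact hX.of_linearEquiv (LinearEquiv.ofBijective φ hφ).symm hXa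

/-- The Noetherian induction covers all ideals, because the prime case calls on `p + (s)`, which
need not be prime. -/
theorem IsThickSubcategory.quotient_ideal [IsLocalRing R] (hR : HasIsolatedSingularity R)
    (hX : IsThickSubcategory X) (hXR : X (FGModuleCat.of R R))
    (hk : X (FGModuleCat.of R (R ⧸ maximalIdeal R))) (a : Ideal R) :
    X (FGModuleCat.of R (R ⧸ a)) := by
  induction a using WellFoundedGT.induction with
  | ind a ih =>
    by_cases ham : a = maximalIdeal R
    · exact ham ▸ hk
    by_cases hap : a.IsPrime
    · have : IsRegularLocalRing (Localization.AtPrime a) := by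
        by_contra h
        exact ham (congrArg PrimeSpectrum.asIdeal (hR (a := ⟨a, hap⟩) h))
      exact hX.quotient_prime hXR a ih
    by_cases hat : a = ⊤
    · have : Subsingleton (R ⧸ a) := Ideal.Quotient.subsingleton_iff.mpr hat
      exact hX.of_subsingleton hXR
    obtain ⟨x, hx, y, hy, hxy⟩ := (Ideal.not_isPrime_iff.mp hap).resolve_left hat
    -- `b = (a : x)` contains `y ∉ a`, so both ends of `0 → R/(a : x) → R/a → R/(a + (x)) → 0` have
    -- strictly larger ideals.
    let b : Ideal R := Submodule.comap (LinearMap.toSpanSingleton R R x) a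
    have hab : a ≤ b := fun r hr => a.mul_mem_right x hr
    have hb : X (FGModuleCat.of R (R ⧸ b)) := ih b <| lt_of_le_of_ne hab fun h => hy (by
      rw [h]; change y * x ∈ a; rwa [mul_comm])
    let c := a ⊔ Ideal.span {x}
    have hac : a ≤ c := le_sup_left
    have hc : X (FGModuleCat.of R (R ⧸ c)) := ih c <| lt_of_le_of_ne hac fun h => hx
      (h ▸ Ideal.mem_sup_right (Ideal.mem_span_singleton_self x))
    refine hX.middle_of_exact (f := Submodule.mapQ b a (LinearMap.toSpanSingleton R R x) le_rfl)
      (g := Submodule.factor hac) ?_ ?_ (Submodule.factor_surjective hac) hb hc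
    · rw [← LinearMap.ker_eq_bot, Submodule.ker_mapQ]
      simp [b]
    · intro z
      obtain ⟨z, rfl⟩ := a.mkQ_surjective z
      refine (Submodule.Quotient.mk_eq_zero c).trans ?_
      constructor
      · intro hz
        obtain ⟨w, hw, v, hv, rfl⟩ := Submodule.mem_sup.mp hz
        obtain ⟨r, rfl⟩ := Ideal.mem_span_singleton.mp hv
        refine ⟨b.mkQ r, (Submodule.Quotient.eq a).mpr ?_⟩
        change r * x - (w + x * r) ∈ a
        rw [show r * x - (w + x * r) = -w by ring]
        exact a.neg_mem hw
      · rintro ⟨r, hr⟩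
        obtain ⟨r, rfl⟩ := b.mkQ_surjective r
        have h1 : r * x - z ∈ a := (Submodule.Quotient.eq a).mp hr
        rw [show z = r * x - (r * x - z) by ring]
        exact c.sub_mem (Ideal.mem_sup_right (Ideal.mul_mem_left _ _
          (Ideal.mem_span_singleton_self x))) (hac h1)

theorem IsThickSubcategory.eq_top_of_residueField [IsLocalRing R] (hR : HasIsolatedSingularity R)
    (hX : IsThickSubcategory X) (hXR : X (FGModuleCat.of R R))
    (hk : X (FGModuleCat.of R (R ⧸ maximalIdeal R))) : X = ⊤ := by
  have key : ∀ (N : Type u) [AddCommGroup N] [Module R N] [hN : Module.Finite R N],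
      X (FGModuleCat.of R N) := by
    intro N _ _ hN
    induction hN using IsNoetherianRing.induction_on_isQuotientEquivQuotientPrime R with
    | subsingleton N => exact hX.of_subsingleton hXR
    | quotient N p e => exact hX.of_linearEquiv e.symm (hX.quotient_ideal hR hXR hk p.1)
    | exact N₁ N₂ N₃ f g hf hg hfg h₁ h₃ => exact hX.middle_of_exact hf hfg hg h₁ h₃
  ext M
  exact ⟨fun _ => trivial, fun _ => key M⟩

end IsolatedSingularity

theorem mainTheorem10 {R : Type u} [CommRing R] [IsNoetherianRing R] [IsLocalRing R]
    (hR : HasIsolatedSingularity R) (n : ℕ) (xs : List R) (hn : xs.length = n)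
    (hxs : IsQuasiDecomposableWith R xs) :
    (∀ X : ObjectProperty (FGModuleCat.{u} R), IsThickSubcategory X →
      X (FGModuleCat.of R R) →
      (∃ M : FGModuleCat.{u} R, X M ∧ ((n + 2 : ℕ) : WithBot ℕ∞) ≤ moduleProjDim M) →
      X = ⊤) ∧
    (¬ ∃ X : ObjectProperty (FGModuleCat.{u} R), IsThickSubcategory X ∧
      finiteProjDim R < X ∧ X < ⊤) := by
  have key : ∀ X : ObjectProperty (FGModuleCat.{u} R), IsThickSubcategory X →
      X (FGModuleCat.of R R) →
      (∃ M : FGModuleCat.{u} R, X M ∧ ((n + 2 : ℕ) : WithBot ℕ∞) ≤ moduleProjDim M) → X = ⊤ := by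
    rintro X hX hXR ⟨M, hM, hpd⟩
    subst hn
    exact hX.eq_top_of_residueField hR hXR (hX.residueField_of_isQuasiDecomposableWith (M := M)
      hXR hxs hM ((projectiveDimension_ge_iff _ _).mp hpd))
  refine ⟨key, ?_⟩
  rintro ⟨X, hX, hlt, htop⟩
  have hXR : X (FGModuleCat.of R R) := hlt.le _ <|
    (projectiveDimension_ne_top_iff (ModuleCat.of R R)).mpr
      ⟨0, (projective_iff_hasProjectiveDimensionLE_zero _).mp inferInstance⟩
  obtain ⟨M, hM, hpd⟩ : ∃ M, X M ∧ ¬ finiteProjDim R M := by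
    by_contra! h
    exact hlt.not_ge fun M hM => h M hM
  refine htop.ne (key X hX hXR ⟨M, hM, ?_⟩)
  -- Outside `PD(R)` the projective dimension is `⊤`, which exceeds every bound `n + 2`.
  rw [not_not.mp hpd]
  exact le_top
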